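/- Let $r,n\ge 0$, let $\Lambda=(\lambda_1,\dots,\lambda_r)$ and $\mathbf{x}=(x_1,\dots,x_n)$ be variables, and let $\rho$ be a total ordering of the group of (Laurent) monomials in $\Lambda,\mathbf{x}$ (equivalently, of $\mathbb{Z}^{r+n}$) compatible with the group structure; $\bar\rho$ denotes the reversed ordering. Let $\mathbb{C}^\rho\langle\!\langle\Lambda,\mathbf{x}\rangle\!\rangle$ be the field of Malcev–Neumann series with respect to $\rho$, i.e. formal series over the monomials with complex coefficients whose support is well-ordered by $\rho$; the field $\mathbb{C}(\Lambda,\mathbf{x})$ embeds in it (expansion with respect to $\rho$). For a series, $\mathrm{CT}_{\lambda_i}$ keeps exactly the terms in which $\lambda_i$ has exponent $0$. For $F\in\mathbb{C}(\Lambda,\mathbf{x})$, $\mathrm{CT}^\rho_{\lambda_k}\cdots\mathrm{CT}^\rho_{\lambda_1}F$ is the iterated constant term of the expansion of $F$ with respect to $\rho$, identified, when it is the expansion of a rational function, with that (unique) rational function; $\mathrm{CT}^\rho_\Lambda=\mathrm{CT}^\rho_{\lambda_r}\cdots\mathrm{CT}^\rho_{\lambda_1}$. For a rational function $G$ and a variable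 $\lambda$ let $\mathcal{I}_\lambda G=\mathrm{CT}_{\lambda=0}G+\mathrm{CT}_{\lambda=\infty}G$, where the two summands are the coefficients of $\lambda^0$ of $G$ expanded in $K((\lambda))$ and in $K((\lambda^{-1}))$ respectively, $K$ being the field of rational functions in the variables other than $\lambda$. Let $F\in\mathbb{C}(\Lambda,\mathbf{x})$ be Elliott-rational, i.e. $F=p/\prod_{i=1}^m(y_i-z_i)$ with $p$ a polynomial in $\Lambda,\mathbf{x}$ over $\mathbb{C}$ and $y_i\neq z_i$ monomials. If $F$ has the I-property with respect to $\rho$, that is, $$\mathcal{I}_{\lambda_i}\,\mathrm{CT}^\rho_{\lambda_{i-1}}\cdots\mathrm{CT}^\rho_{\lambda_1}F=0\qquad\text{for } i=1,\dots,r,$$ then $F$ has the R-property with respect to $\rho$: $\mathrm{CT}^\rho_\Lambda F$ and $\mathrm{CT}^{\bar\rho}_\Lambda F$ are (expansions of) rational functions in $\mathbb{C}(\mathbf{x})$, and as such $$\mathrm{CT}^\rho_\Lambda F=(-1)^r\,\mathrm{CT}^{\bar\rho}_\Lambda F.$$ -/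

import Mathlib

noncomputable section

namespace MNRec

/-! ### Rational functions and Elliott-rational functions -/

/-- The field `ℂ(σ)` of rational functions over `ℂ` in the variables indexed by `σ`. -/
abbrev RatFn (σ : Type) : Type := FractionRing (MvPolynomial σ ℂ)

/-- The (Laurent) monomial with exponent vector `m`, as a rational function. -/
def ratMonomial {σ : Type} [Fintype σ] (m : σ → ℤ) : RatFn σ :=
  ∏ i, (algebraMap (MvPolynomial σ ℂ) (RatFn σ) (MvPolynomial.X i)) ^ m i

/-- `F = p / ∏ (yᵢ - zᵢ)` with `p` a polynomial and `yᵢ`, `zᵢ` monomials; `yᵢ ≠ zᵢ` says that the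
denominator is not zero. -/
def IsElliottRational {σ : Type} [Fintype σ] (F : RatFn σ) : Prop :=
  ∃ (p : MvPolynomial σ ℂ) (m : ℕ) (y z : Fin m → σ → ℤ), (∀ i, y i ≠ z i) ∧
    F = algebraMap (MvPolynomial σ ℂ) (RatFn σ) p /
      ∏ i, (ratMonomial (y i) - ratMonomial (z i))

/-! ### Total orderings of the group of monomials -/

/-- A total ordering of the additive group `ℤ^σ` (equivalently, of the group of monomials in the
variables indexed by `σ`) that is compatible with the group structure. -/
structure GroupOrder (σ : Type) where
  le : (σ → ℤ) → (σ → ℤ) → Prop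
  le_refl : ∀ a, le a a
  le_trans : ∀ a b c, le a b → le b c → le a c
  le_antisymm : ∀ a b, le a b → le b a → a = b
  le_total : ∀ a b, le a b ∨ le b a
  add_le_add : ∀ a b c, le a b → le (a + c) (b + c)

/-- The reversed ordering `ρ̄` of `ρ`. -/
def GroupOrder.reverse {σ : Type} (ρ : GroupOrder σ) : GroupOrder σ where
  le a b := ρ.le b a
  le_refl := ρ.le_refl
  le_trans a b c hab hbc := ρ.le_trans c b a hbc hab
  le_antisymm a b hab hba := ρ.le_antisymm a b hba hab
  le_total a b := ρ.le_total b a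
  add_le_add a b c h := ρ.add_le_add b a c h

/-- The group `ℤ^σ`, ordered by `ρ`. -/
def OrdExp {σ : Type} (_ρ : GroupOrder σ) : Type := σ → ℤ

instance {σ : Type} (ρ : GroupOrder σ) : AddCommGroup (OrdExp ρ) :=
  inferInstanceAs (AddCommGroup (σ → ℤ))

open Classical in
instance {σ : Type} (ρ : GroupOrder σ) : LinearOrder (OrdExp ρ) where
  le := ρ.le
  le_refl := ρ.le_refl
  le_trans := ρ.le_trans
  le_antisymm := ρ.le_antisymm
  le_total := ρ.le_total
  toDecidableLE := Classical.decRel _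

instance {σ : Type} (ρ : GroupOrder σ) : IsOrderedAddMonoid (OrdExp ρ) where
  add_le_add_left a b h c := ρ.add_le_add a b c h

/-! ### Malcev-Neumann series -/

/-- The field `ℂ^ρ⟪σ⟫` of Malcev-Neumann series: formal series over the monomials whose support is
well-ordered with respect to `ρ`. -/
abbrev MNSeries {σ : Type} (ρ : GroupOrder σ) : Type := HahnSeries (OrdExp ρ) ℂ

section Expand

variable {σ : Type} [DecidableEq σ] (ρ : GroupOrder σ)

/-- The exponent vector of the variable `i`. -/
def OrdExp.basis (i : σ) : OrdExp ρ := (Pi.single i 1 : σ → ℤ)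

/-- A polynomial as a (finitely supported) Malcev-Neumann series. -/
def expandPoly : MvPolynomial σ ℂ →+* MNSeries ρ :=
  MvPolynomial.eval₂Hom HahnSeries.C fun i => HahnSeries.single (OrdExp.basis ρ i) 1

/-- The exponent vector of a monomial of a polynomial. -/
def OrdExp.ofFinsupp (m : σ →₀ ℕ) : OrdExp ρ := (fun i => (m i : ℤ) : σ → ℤ)

theorem expandPoly_monomial (m : σ →₀ ℕ) (c : ℂ) :
    expandPoly ρ (MvPolynomial.monomial m c) = HahnSeries.single (OrdExp.ofFinsupp ρ m) c := by
  induction m using Finsupp.induction_linear generalizing c with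
  | zero =>
    have h0 : OrdExp.ofFinsupp ρ 0 = 0 := rfl
    rw [h0]
    simp [expandPoly, HahnSeries.C_apply]
  | add f g hf hg =>
    have h : MvPolynomial.monomial (f + g) c
        = MvPolynomial.monomial f c * MvPolynomial.monomial g 1 := by
      simp [MvPolynomial.monomial_mul]
    have h2 : OrdExp.ofFinsupp ρ (f + g) = OrdExp.ofFinsupp ρ f + OrdExp.ofFinsupp ρ g := by
      funext i
      exact Nat.cast_add (f i) (g i)
    rw [h, map_mul, hf, hg, h2, HahnSeries.single_mul_single, mul_one]
  | single i k =>
    have h2 : OrdExp.ofFinsupp ρ (Finsupp.single i k) = k • OrdExp.basis ρ i := by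
      funext j
      change ((Finsupp.single i k j : ℕ) : ℤ) = (k • (Pi.single i 1 : σ → ℤ)) j
      by_cases h : i = j
      · subst h; simp
      · simp [h, Ne.symm h]
    rw [h2]
    simp [expandPoly, MvPolynomial.eval₂_monomial, HahnSeries.C_apply, HahnSeries.single_pow,
      HahnSeries.single_mul_single]

theorem expandPoly_coeff (p : MvPolynomial σ ℂ) (m : σ →₀ ℕ) :
    (expandPoly ρ p).coeff (OrdExp.ofFinsupp ρ m) = p.coeff m := by
  induction p using MvPolynomial.induction_on' with
  | monomial u a =>
    rw [expandPoly_monomial, MvPolynomial.coeff_monomial]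
    by_cases h : u = m
    · simp [h]
    · rw [HahnSeries.coeff_single_of_ne, if_neg h]
      intro h'
      apply h
      ext i
      exact (Nat.cast_injective (R := ℤ) (congrFun h' i)).symm
  | add p q hp hq => simp [hp, hq]

theorem expandPoly_injective : Function.Injective (expandPoly ρ) := by
  intro p q h
  ext m
  rw [← expandPoly_coeff ρ p m, ← expandPoly_coeff ρ q m, h]

/-- The expansion of rational functions: the embedding of the field `ℂ(σ)` into the field of
Malcev-Neumann series with respect to `ρ`. -/
def expand : RatFn σ →+* MNSeries ρ := IsFractionRing.lift (expandPoly_injective ρ)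

end Expand

/-- The constant term in the variable `i` of a Malcev-Neumann series: only the terms that are free
of the variable `i` are kept. -/
def constTerm {σ : Type} {ρ : GroupOrder σ} (i : σ) (f : MNSeries ρ) : MNSeries ρ := by
  classical
  exact
    { coeff := fun m => if (m : σ → ℤ) i = 0 then f.coeff m else 0
      isPWO_support' := f.isPWO_support.mono fun m hm => by
        intro h
        apply hm
        simp [h] }

/-! ### The operators `CT_{v=0}`, `CT_{v=∞}` and `I_v` -/

section Invariant

variable {σ : Type} [DecidableEq σ]

/-- A polynomial in the variables `σ` as a polynomial in the variable `v` over the field of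
rational functions in the other variables. -/
def polyIn (v : σ) : MvPolynomial σ ℂ →+* Polynomial (RatFn {j : σ // j ≠ v}) :=
  MvPolynomial.eval₂Hom (Polynomial.C.comp (algebraMap ℂ (RatFn {j : σ // j ≠ v}))) fun j =>
    if h : j = v then Polynomial.X
    else Polynomial.C (algebraMap (MvPolynomial {j : σ // j ≠ v} ℂ) (RatFn {j : σ // j ≠ v})
      (MvPolynomial.X ⟨j, h⟩))

theorem polyIn_injective (v : σ) : Function.Injective (polyIn v) := by
  have key : polyIn v = ((Polynomial.mapRingHom
      (algebraMap (MvPolynomial {j : σ // j ≠ v} ℂ) (RatFn {j : σ // j ≠ v}))).comp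
      (MvPolynomial.optionEquivLeft ℂ {j : σ // j ≠ v}).toRingEquiv.toRingHom).comp
      (MvPolynomial.renameEquiv ℂ (Equiv.optionSubtypeNe v).symm).toRingEquiv.toRingHom := by
    apply MvPolynomial.ringHom_ext
    · intro c
      simp [polyIn, MvPolynomial.optionEquivLeft_C, IsScalarTower.algebraMap_apply ℂ
        (MvPolynomial {j : σ // j ≠ v} ℂ) (RatFn {j : σ // j ≠ v})]
    · intro j
      by_cases h : j = v
      · subst h
        simp [polyIn, MvPolynomial.optionEquivLeft_X_none]
      · simp [polyIn, h, Equiv.optionSubtypeNe_symm_of_ne h, MvPolynomial.optionEquivLeft_X_some]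
  rw [key]
  exact ((Polynomial.map_injective _ (IsFractionRing.injective _ _)).comp
    (AlgEquiv.injective _)).comp (AlgEquiv.injective _)

/-- The substitution `v ↦ u ^ ε` from `K[v]` to the field `K((u))` of formal Laurent series. -/
def laurentSubst (K : Type) [Field K] (ε : ℤ) : Polynomial K →+* LaurentSeries K :=
  Polynomial.eval₂RingHom HahnSeries.C (HahnSeries.single ε 1)

theorem laurentSubst_injective (K : Type) [Field K] {ε : ℤ} (hε : ε ≠ 0) :
    Function.Injective (laurentSubst K ε) := by
  have key : ∀ (p : Polynomial K) (k : ℕ), (laurentSubst K ε p).coeff (k • ε) = p.coeff k := by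
    intro p k
    induction p using Polynomial.induction_on' with
    | add p q hp hq => simp only [map_add, HahnSeries.coeff_add, Polynomial.coeff_add, hp, hq]
    | monomial l a =>
      have h : laurentSubst K ε (Polynomial.monomial l a) = HahnSeries.single (l • ε) a := by
        simp [laurentSubst, Polynomial.eval₂_monomial, HahnSeries.C_apply, HahnSeries.single_pow,
          HahnSeries.single_mul_single]
      rw [h, Polynomial.coeff_monomial]
      by_cases hl : l = k
      · simp [hl]
      · rw [HahnSeries.coeff_single_of_ne, if_neg hl]
        intro h'
        apply hl
        simpa [hε, eq_comm] using h'
  intro p q h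
  ext k
  rw [← key p k, ← key q k, h]

/-- The embedding of `ℂ(σ) = K(v)` into `K((v))`, where `K` is the field of rational functions in
the variables other than `v`. -/
def expandAtZero (v : σ) : RatFn σ →+* LaurentSeries (RatFn {j : σ // j ≠ v}) :=
  IsFractionRing.lift (g := (laurentSubst (RatFn {j : σ // j ≠ v}) 1).comp (polyIn v))
    ((laurentSubst_injective _ one_ne_zero).comp (polyIn_injective v))

/-- The embedding of `ℂ(σ) = K(v)` into `K((v⁻¹))`; a series is indexed by the powers
of `v⁻¹`. -/
def expandAtInfty (v : σ) : RatFn σ →+* LaurentSeries (RatFn {j : σ // j ≠ v}) :=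
  IsFractionRing.lift (g := (laurentSubst (RatFn {j : σ // j ≠ v}) (-1)).comp (polyIn v))
    ((laurentSubst_injective _ (neg_ne_zero.mpr one_ne_zero)).comp (polyIn_injective v))

/-- `I_v F = CT_{v=0} F + CT_{v=∞} F`, a rational function in the variables other than `v`. -/
def invariantI (v : σ) (F : RatFn σ) : RatFn {j : σ // j ≠ v} :=
  (expandAtZero v F).coeff 0 + (expandAtInfty v F).coeff 0

end Invariant

/-! ### The I-property and the R-property

The variables are `λ₁, …, λ_r` (the left summand) and `x₁, …, x_n` (the right summand). -/

section Properties

variable {r n : ℕ}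

/-- `CT_{λ_k} ⋯ CT_{λ₁} f`, for `0 ≤ k ≤ r`. -/
def iterConstTerm {ρ : GroupOrder (Fin r ⊕ Fin n)} (f : MNSeries ρ) (k : Fin (r + 1)) :
    MNSeries ρ :=
  Fin.induction (motive := fun _ => MNSeries ρ) f (fun i g => constTerm (Sum.inl i) g) k

/-- The rational function `G` is `CT^ρ_{λ_k} ⋯ CT^ρ_{λ₁} F`: its expansion with respect to `ρ` is
the iterated constant term of the expansion of `F`. Since expansion is injective, there is at most
one such `G`. -/
def IsIterCT (ρ : GroupOrder (Fin r ⊕ Fin n)) (k : Fin (r + 1)) (F G : RatFn (Fin r ⊕ Fin n)) :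
    Prop :=
  expand ρ G = iterConstTerm (expand ρ F) k

/-- The I-property with respect to `ρ`: for `i = 1, …, r`, the operator `I_{λ_i}` annihilates the
rational function `CT^ρ_{λ_{i-1}} ⋯ CT^ρ_{λ₁} F`. -/
def IProperty (ρ : GroupOrder (Fin r ⊕ Fin n)) (F : RatFn (Fin r ⊕ Fin n)) : Prop :=
  ∀ (i : Fin r) (G : RatFn (Fin r ⊕ Fin n)), IsIterCT ρ i.castSucc F G →
    invariantI (Sum.inl i) G = 0

/-- The inclusion `ℂ(x) ⊆ ℂ(Λ, x)`. -/
def inclX (r n : ℕ) : RatFn (Fin n) →+* RatFn (Fin r ⊕ Fin n) :=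
  IsFractionRing.map (A := MvPolynomial (Fin n) ℂ) (B := MvPolynomial (Fin r ⊕ Fin n) ℂ)
    (j := (MvPolynomial.rename (Sum.inr : Fin n → Fin r ⊕ Fin n)).toRingHom)
    (MvPolynomial.rename_injective _ Sum.inr_injective)

/-- The R-property with respect to `ρ`: the constant terms in `Λ` of `F` with respect to `ρ` and to
its reverse are rational functions `G` and `G'` of `x`, and `G = (-1)^r G'`. -/
def RProperty (ρ : GroupOrder (Fin r ⊕ Fin n)) (F : RatFn (Fin r ⊕ Fin n)) : Prop :=
  ∃ G G' : RatFn (Fin n),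
    IsIterCT ρ (Fin.last r) F (inclX r n G) ∧
    IsIterCT ρ.reverse (Fin.last r) F (inclX r n G') ∧
    G = (-1) ^ r * G'

end Properties

end MNRec

end

/-! Everything rests on a one-variable reciprocity: if `F` is a sum of terms `c x^a / ∏ (1 - x^m)`,
then its constant terms in `v` with respect to `ρ` and to `ρ̄` are again such sums, now free of `v`,
and they add up to `I_v F` (`hasReciprocalCT_of_mem_elliottSpan`). When `I_v F = 0`, passing from
`ρ` to `ρ̄` therefore only changes the sign. Because this class of functions is stable under
constant terms, the argument can be repeated for each `λ_i`, which gives `(-1)^r`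
(`IProperty.exists_isIterCT`).

For the reciprocity, orient every factor so that `m` is `ρ`-positive. If all these `m` have
`v`-degree at least `0`, the constant term in `v` of the `ρ`-expansion is that of the expansion at
`v = 0`, and `ρ̄` likewise corresponds to `v = ∞`; if all degrees are at most `0`, the roles are
exchanged (`hasReciprocalCT_elliottTerm_of_direction`). Mixed directions are removed in two moves.
Finite geometric sums bring all nonzero degrees to `±M` (`elliottTerm_cons_eq_sum`). Elliott's
identity then replaces a pair of opposite factors by terms containing their product, which is free
of `v` (`elliottTerm_cons_cons`). -/

set_option linter.unusedSectionVars false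

namespace MNRec

open HahnSeries

/-! ### Hahn series whose exponents are bounded below by an additive functional -/

section SupportBound

variable {Γ R : Type*} [AddCommGroup Γ] [LinearOrder Γ] [IsOrderedAddMonoid Γ] [Field R]

/-- All exponents of `f` have value at least `t` under `ℓ`. -/
def SupportBound (ℓ : Γ →+ ℤ) (t : ℤ) (f : HahnSeries Γ R) : Prop :=
  ∀ b, f.coeff b ≠ 0 → t ≤ ℓ b

theorem SupportBound.mul {ℓ : Γ →+ ℤ} {t u : ℤ} {f g : HahnSeries Γ R}
    (hf : SupportBound ℓ t f) (hg : SupportBound ℓ u g) : SupportBound ℓ (t + u) (f * g) := by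
  intro b hb
  obtain ⟨x, hx, y, hy, rfl⟩ := Set.mem_add.mp (support_mul_subset (mem_support _ _ |>.mpr hb))
  rw [map_add]
  exact add_le_add (hf x hx) (hg y hy)

theorem supportBound_single (ℓ : Γ →+ ℤ) (m : Γ) (c : R) :
    SupportBound ℓ (ℓ m) (single m c) := by
  intro b hb
  by_cases h : b = m
  · rw [h]
  · exact absurd (coeff_single_of_ne h) hb

theorem supportBound_C (ℓ : Γ →+ ℤ) (c : R) : SupportBound ℓ 0 (C c : HahnSeries Γ R) := by
  simpa [C_apply] using supportBound_single ℓ (0 : Γ) c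

/-- The inverse `f` satisfies `f = 1 + c x^m f`. An exponent `b` of `f` with `ℓ b < 0` is not `0`,
so `b - m` is also an exponent; it is smaller and still has negative value. This contradicts the
choice of a least such `b`, which exists by well-ordering of the support. -/
theorem supportBound_inv_one_sub_single (ℓ : Γ →+ ℤ) {m : Γ} (hm : 0 < m) (hℓ : 0 ≤ ℓ m) (c : R) :
    SupportBound ℓ 0 (1 - single m c : HahnSeries Γ R)⁻¹ := by
  set f : HahnSeries Γ R := (1 - single m c)⁻¹ with hf
  have hne : (1 - single m c : HahnSeries Γ R) ≠ 0 := by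
    intro h
    have := congrArg (fun g => g.coeff 0) h
    simp [coeff_single_of_ne hm.ne] at this
  have hmul : f - single m c * f = 1 := by
    rw [← one_sub_mul]
    exact mul_inv_cancel₀ hne
  by_contra hcon
  obtain ⟨b, hb, hlt⟩ : ∃ b, f.coeff b ≠ 0 ∧ ℓ b < 0 := by
    simpa [SupportBound] using hcon
  have hwf : (f.support ∩ {b | ℓ b < 0}).IsWF := f.isWF_support.mono Set.inter_subset_left
  have hn : (f.support ∩ {b | ℓ b < 0}).Nonempty := ⟨b, hb, hlt⟩
  obtain ⟨h1, h2⟩ := hwf.min_mem hn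
  refine hwf.not_lt_min hn (a := hwf.min hn - m) ⟨?_, ?_⟩ (sub_lt_self _ hm)
  · intro h0
    have hc := congrArg (fun g => g.coeff (hwf.min hn)) hmul
    have hz : hwf.min hn ≠ 0 := by
      intro h
      have h2' : ℓ (hwf.min hn) < 0 := h2
      rw [h, map_zero] at h2'
      exact lt_irrefl _ h2'
    rw [coeff_sub, coeff_single_mul, h0, mul_zero, sub_zero, coeff_one, if_neg hz] at hc
    exact h1 hc
  · have h2' : ℓ (hwf.min hn) < 0 := h2
    simp only [Set.mem_ofPred_eq, map_sub]
    omega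

theorem supportBound_multiset_prod (ℓ : Γ →+ ℤ) {α : Type*} (s : Multiset α)
    (f : α → HahnSeries Γ R) (h : ∀ m ∈ s, SupportBound ℓ 0 (f m)) :
    SupportBound ℓ 0 (s.map f).prod := by
  induction s using Multiset.induction_on with
  | empty => simpa using supportBound_C ℓ (1 : R)
  | cons m s ih =>
    rw [Multiset.map_cons, Multiset.prod_cons]
    simpa using (h m (Multiset.mem_cons_self m s)).mul
      (ih fun x hx => h x (Multiset.mem_cons_of_mem hx))

theorem single_one_zpow (m : Γ) (k : ℤ) :
    (single m (1 : R)) ^ k = single (k • m) 1 := by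
  cases k with
  | ofNat k => simp [single_pow]
  | negSucc k => simp [zpow_negSucc, single_pow, inv_single, negSucc_zsmul]

theorem prod_single_one {ι : Type*} (s : Finset ι) (f : ι → Γ) :
    ∏ i ∈ s, single (f i) (1 : R) = single (∑ i ∈ s, f i) 1 := by
  classical
  induction s using Finset.induction_on with
  | empty => rfl
  | insert a s ha ih =>
    rw [Finset.prod_insert ha, Finset.sum_insert ha, ih, single_mul_single, mul_one]

end SupportBound

/-! ### Monomials and Elliott terms -/

section Elliott

variable {σ : Type} [Fintype σ]

theorem algebraMap_X_ne_zero (i : σ) :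
    algebraMap (MvPolynomial σ ℂ) (RatFn σ) (MvPolynomial.X i) ≠ 0 := by
  rw [Ne, IsFractionRing.to_map_eq_zero_iff]
  exact MvPolynomial.X_ne_zero i

theorem ratMonomial_zero : ratMonomial (0 : σ → ℤ) = 1 := by
  simp [ratMonomial]

theorem ratMonomial_add (a b : σ → ℤ) :
    ratMonomial (a + b) = ratMonomial a * ratMonomial b := by
  simp [ratMonomial, zpow_add₀ (algebraMap_X_ne_zero _), Finset.prod_mul_distrib]

theorem ratMonomial_ne_zero (a : σ → ℤ) : ratMonomial a ≠ 0 :=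
  Finset.prod_ne_zero_iff.mpr fun i _ => zpow_ne_zero _ (algebraMap_X_ne_zero i)

theorem ratMonomial_neg (a : σ → ℤ) : ratMonomial (-a) = (ratMonomial a)⁻¹ := by
  apply eq_inv_of_mul_eq_one_left
  rw [← ratMonomial_add, neg_add_cancel, ratMonomial_zero]

theorem ratMonomial_nsmul (k : ℕ) (a : σ → ℤ) : ratMonomial (k • a) = ratMonomial a ^ k := by
  induction k with
  | zero => rw [zero_smul, pow_zero, ratMonomial_zero]
  | succ k ih => rw [succ_nsmul, ratMonomial_add, ih, pow_succ]

/-- The term `c x^a / ∏_{m ∈ s} (1 - x^m)`. -/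
noncomputable def elliottTerm (c : ℂ) (a : σ → ℤ) (s : Multiset (σ → ℤ)) : RatFn σ :=
  algebraMap ℂ (RatFn σ) c * ratMonomial a * (s.map fun m => (1 - ratMonomial m)⁻¹).prod

theorem elliottTerm_cons (c : ℂ) (a m : σ → ℤ) (s : Multiset (σ → ℤ)) :
    elliottTerm c a (m ::ₘ s) = (1 - ratMonomial m)⁻¹ * elliottTerm c a s := by
  rw [elliottTerm, elliottTerm, Multiset.map_cons, Multiset.prod_cons]
  ring

theorem elliottTerm_add (c : ℂ) (a b : σ → ℤ) (s : Multiset (σ → ℤ)) :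
    elliottTerm c (a + b) s = ratMonomial b * elliottTerm c a s := by
  rw [elliottTerm, elliottTerm, ratMonomial_add]
  ring

theorem elliottTerm_neg (c : ℂ) (a : σ → ℤ) (s : Multiset (σ → ℤ)) :
    elliottTerm (-c) a s = -elliottTerm c a s := by
  rw [elliottTerm, elliottTerm, map_neg]
  ring

/-- The additive span of the terms `c x^a / ∏_{m ∈ s} (1 - x^m)` with exponents in `S`. -/
noncomputable def elliottSpan (S : AddSubgroup (σ → ℤ)) : AddSubmonoid (RatFn σ) :=
  AddSubmonoid.closure
    {F | ∃ c a s, a ∈ S ∧ (∀ m ∈ s, m ∈ S ∧ m ≠ 0) ∧ F = elliottTerm c a s}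

theorem elliottTerm_mem_elliottSpan {S : AddSubgroup (σ → ℤ)} (c : ℂ) {a : σ → ℤ}
    {s : Multiset (σ → ℤ)} (ha : a ∈ S) (hs : ∀ m ∈ s, m ∈ S ∧ m ≠ 0) :
    elliottTerm c a s ∈ elliottSpan S :=
  AddSubmonoid.subset_closure ⟨c, a, s, ha, hs, rfl⟩

theorem IsElliottRational.mem_elliottSpan {F : RatFn σ} (hF : IsElliottRational F) :
    F ∈ elliottSpan (⊤ : AddSubgroup (σ → ℤ)) := by
  obtain ⟨p, k, y, z, hyz, rfl⟩ := hF
  -- Uses `1 / (y - z) = y⁻¹ / (1 - z / y)` in each factor.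
  have hden : (∏ i, (ratMonomial (y i) - ratMonomial (z i)))⁻¹ =
      elliottTerm 1 (-∑ i, y i) (Finset.univ.val.map fun i => z i - y i) := by
    have hprod : ∀ s : Finset (Fin k), ratMonomial (∑ i ∈ s, y i) = ∏ i ∈ s, ratMonomial (y i) := by
      intro s
      induction s using Finset.induction_on with
      | empty => simp [ratMonomial_zero]
      | insert a s ha ih => rw [Finset.sum_insert ha, Finset.prod_insert ha, ratMonomial_add, ih]
    have hfac : ∀ i, (ratMonomial (y i) - ratMonomial (z i))⁻¹ =
        (ratMonomial (y i))⁻¹ * (1 - ratMonomial (z i - y i))⁻¹ := by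
      intro i
      rw [← mul_inv, mul_sub, mul_one, ← ratMonomial_add, add_sub_cancel]
    rw [elliottTerm, map_one, one_mul, ratMonomial_neg, hprod, Multiset.map_map,
      ← Finset.prod_inv_distrib, ← Finset.prod_inv_distrib, Finset.prod_congr rfl fun i _ => hfac i,
      Finset.prod_mul_distrib]
    rfl
  rw [div_eq_mul_inv, hden]
  set s : Multiset (σ → ℤ) := Finset.univ.val.map fun i => z i - y i with hs
  have hs0 : ∀ m ∈ s, m ∈ (⊤ : AddSubgroup (σ → ℤ)) ∧ m ≠ 0 := by
    intro m hm
    obtain ⟨i, _, rfl⟩ := Multiset.mem_map.mp hm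
    exact ⟨AddSubgroup.mem_top _, sub_ne_zero.mpr (hyz i).symm⟩
  clear_value s
  induction p using MvPolynomial.induction_on' with
  | monomial u c =>
    have : algebraMap (MvPolynomial σ ℂ) (RatFn σ) (MvPolynomial.monomial u c) =
        algebraMap ℂ (RatFn σ) c * ratMonomial fun i => (u i : ℤ) := by
      rw [MvPolynomial.monomial_eq, map_mul, ratMonomial, Finsupp.prod_fintype _ _ (by simp),
        map_prod, IsScalarTower.algebraMap_apply ℂ (MvPolynomial σ ℂ) (RatFn σ)]
      simp
    have h2 : algebraMap (MvPolynomial σ ℂ) (RatFn σ) (MvPolynomial.monomial u c) *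
        elliottTerm 1 (-∑ i, y i) s = elliottTerm c (-∑ i, y i + fun i => (u i : ℤ)) s := by
      rw [this, elliottTerm_add, elliottTerm, elliottTerm, map_one]
      ring
    rw [h2]
    exact elliottTerm_mem_elliottSpan _ (AddSubgroup.mem_top _) hs0
  | add p q hp hq => rw [map_add, add_mul]; exact add_mem hp hq

end Elliott

/-! ### Expansions of Elliott terms -/

section Expansion

variable {σ : Type} [Fintype σ] [DecidableEq σ]

/-- An exponent vector as an element of the ordered group. -/
def OrdExp.of (ρ : GroupOrder σ) : (σ → ℤ) →+ OrdExp ρ := AddMonoidHom.id (σ → ℤ)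

/-- The exponent of the variable `v`. -/
def OrdExp.degree (ρ : GroupOrder σ) (v : σ) : OrdExp ρ →+ ℤ :=
  Pi.evalAddMonoidHom (fun _ : σ => ℤ) v

theorem OrdExp.of_injective (ρ : GroupOrder σ) : Function.Injective (OrdExp.of ρ) :=
  Function.injective_id

theorem expand_algebraMap_C (ρ : GroupOrder σ) (c : ℂ) :
    expand ρ (algebraMap ℂ (RatFn σ) c) = C c := by
  rw [IsScalarTower.algebraMap_apply ℂ (MvPolynomial σ ℂ) (RatFn σ), expand,
    IsFractionRing.lift_algebraMap, MvPolynomial.algebraMap_eq, expandPoly]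
  simp

theorem expand_ratMonomial (ρ : GroupOrder σ) (m : σ → ℤ) :
    expand ρ (ratMonomial m) = single (OrdExp.of ρ m) 1 := by
  have hX : ∀ i, expand ρ (algebraMap (MvPolynomial σ ℂ) (RatFn σ) (MvPolynomial.X i)) =
      single (OrdExp.basis ρ i) 1 := by
    intro i
    rw [expand, IsFractionRing.lift_algebraMap, expandPoly]
    simp
  have hm : ∑ i, m i • OrdExp.basis ρ i = OrdExp.of ρ m := by
    change ∑ i, m i • (Pi.single i 1 : σ → ℤ) = m
    ext j
    simp [Finset.sum_apply, Pi.single_apply]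
  rw [ratMonomial, map_prod, ← hm, ← prod_single_one]
  exact Finset.prod_congr rfl fun i _ => by rw [map_zpow₀, hX, single_one_zpow]

/-- The order `ρ` is auxiliary: it supplies an expansion in which the two monomials have different
supports. -/
theorem ratMonomial_ne_one (ρ : GroupOrder σ) {m : σ → ℤ} (hm : m ≠ 0) : ratMonomial m ≠ 1 := by
  intro h
  have h1 := congrArg (fun g => (expand ρ g).coeff (OrdExp.of ρ m)) h
  simp only [expand_ratMonomial, map_one, coeff_single_same, coeff_one] at h1
  rw [if_neg] at h1
  · exact one_ne_zero h1
  · exact fun h0 => hm (OrdExp.of_injective ρ (h0.trans (map_zero _).symm))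

theorem one_sub_ratMonomial_ne_zero (ρ : GroupOrder σ) {m : σ → ℤ} (hm : m ≠ 0) :
    1 - ratMonomial m ≠ 0 :=
  sub_ne_zero.mpr (ratMonomial_ne_one ρ hm).symm

theorem map_elliottTerm {L : Type*} [Field L] (φ : RatFn σ →+* L) (c : ℂ) (a : σ → ℤ)
    (s : Multiset (σ → ℤ)) : φ (elliottTerm c a s) = φ (algebraMap ℂ (RatFn σ) c) *
      φ (ratMonomial a) * (s.map fun m => (1 - φ (ratMonomial m))⁻¹).prod := by
  rw [elliottTerm, map_mul, map_mul, map_multiset_prod, Multiset.map_map]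
  simp

/-- Elements of `S` that are free of the variable `v`. -/
def freeOf (S : AddSubgroup (σ → ℤ)) (v : σ) : AddSubgroup (σ → ℤ) :=
  S ⊓ (Pi.evalAddMonoidHom (fun _ : σ => ℤ) v).ker

/-- Factors that are `ρ`-positive and point in the direction `ε` contribute only powers of `v` in
that direction, so the numerator alone determines the bound. -/
theorem supportBound_expand_elliottTerm (ρ : GroupOrder σ) (v : σ) (ε : ℤ) (c : ℂ) (a : σ → ℤ)
    {s : Multiset (σ → ℤ)} (hs : ∀ m ∈ s, 0 < OrdExp.of ρ m ∧ 0 ≤ ε * m v) :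
    SupportBound (ε • OrdExp.degree ρ v) (ε * a v) (expand ρ (elliottTerm c a s)) := by
  have h := ((supportBound_C (ε • OrdExp.degree ρ v) c).mul
    (supportBound_single (ε • OrdExp.degree ρ v) (OrdExp.of ρ a) (1 : ℂ))).mul
    (supportBound_multiset_prod (ε • OrdExp.degree ρ v) s
      (fun m => (1 - single (OrdExp.of ρ m) (1 : ℂ))⁻¹)
      fun m hm => supportBound_inv_one_sub_single _ (hs m hm).1 (hs m hm).2 1)
  rw [zero_add, add_zero] at h
  simp only [map_elliottTerm, expand_algebraMap_C, expand_ratMonomial]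
  exact h

theorem constTerm_coeff {ρ : GroupOrder σ} (v : σ) (f : MNSeries ρ) (b : OrdExp ρ) :
    (constTerm v f).coeff b = if OrdExp.degree ρ v b = 0 then f.coeff b else 0 := by
  classical
  simp only [constTerm]
  congr

theorem constTerm_add {ρ : GroupOrder σ} (v : σ) (f g : MNSeries ρ) :
    constTerm v (f + g) = constTerm v f + constTerm v g := by
  ext b
  simp only [constTerm_coeff, coeff_add]
  split_ifs <;> simp

theorem constTerm_zero {ρ : GroupOrder σ} (v : σ) : constTerm v (0 : MNSeries ρ) = 0 := by
  ext b
  simp [constTerm_coeff]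

theorem constTerm_neg {ρ : GroupOrder σ} (v : σ) (f : MNSeries ρ) :
    constTerm v (-f) = -constTerm v f := by
  ext b
  simp only [constTerm_coeff, coeff_neg]
  split_ifs <;> simp

theorem constTerm_eq_zero_of_supportBound {ρ : GroupOrder σ} {v : σ} {ε t : ℤ} {f : MNSeries ρ}
    (hf : SupportBound (ε • OrdExp.degree ρ v) t f) (ht : 0 < t) : constTerm v f = 0 := by
  ext b
  rw [constTerm_coeff, coeff_zero]
  split_ifs with hb
  · by_contra hne
    have := hf b hne
    rw [AddMonoidHom.smul_apply, hb, smul_zero] at this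
    omega
  · rfl

theorem constTerm_eq_self_of_supportBound {ρ : GroupOrder σ} {v : σ} {f : MNSeries ρ}
    (h₁ : SupportBound ((1 : ℤ) • OrdExp.degree ρ v) 0 f)
    (h₂ : SupportBound ((-1 : ℤ) • OrdExp.degree ρ v) 0 f) : constTerm v f = f := by
  ext b
  rw [constTerm_coeff]
  split_ifs with hb
  · rfl
  · by_contra hne
    have h1 := h₁ b (Ne.symm hne)
    have h2 := h₂ b (Ne.symm hne)
    rw [AddMonoidHom.smul_apply, smul_eq_mul] at h1 h2
    omega

end Expansion

/-! ### Constant terms of Elliott terms whose factors point in the same direction -/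

section Direction

variable {σ : Type} [Fintype σ] [DecidableEq σ]

/-- The inclusion of the rational functions that are free of the variable `v`. -/
noncomputable def inclNe (v : σ) : RatFn {j : σ // j ≠ v} →+* RatFn σ :=
  IsFractionRing.map (A := MvPolynomial {j : σ // j ≠ v} ℂ) (B := MvPolynomial σ ℂ)
    (j := (MvPolynomial.rename (Subtype.val : {j : σ // j ≠ v} → σ)).toRingHom)
    (MvPolynomial.rename_injective _ Subtype.val_injective)

theorem inclNe_algebraMap (v : σ) (p : MvPolynomial {j : σ // j ≠ v} ℂ) :
    inclNe v (algebraMap _ _ p) = algebraMap (MvPolynomial σ ℂ) (RatFn σ)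
      (MvPolynomial.rename Subtype.val p) := by
  rw [inclNe, IsFractionRing.map, IsLocalization.map_eq]
  rfl

theorem inclNe_algebraMap_C (v : σ) (c : ℂ) :
    inclNe v (algebraMap ℂ _ c) = algebraMap ℂ (RatFn σ) c := by
  rw [IsScalarTower.algebraMap_apply ℂ (MvPolynomial {j : σ // j ≠ v} ℂ), inclNe_algebraMap,
    IsScalarTower.algebraMap_apply ℂ (MvPolynomial σ ℂ) (RatFn σ)]
  simp [MvPolynomial.algebraMap_eq]

theorem ratMonomial_eq_inclNe_mul (v : σ) (m : σ → ℤ) :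
    ratMonomial m = inclNe v (ratMonomial fun j => m j) *
      algebraMap (MvPolynomial σ ℂ) (RatFn σ) (MvPolynomial.X v) ^ m v := by
  rw [ratMonomial, ratMonomial, map_prod, ← Finset.prod_erase_mul _ _ (Finset.mem_univ v)]
  congr 1
  rw [Finset.prod_subtype (p := fun j => j ≠ v) (Finset.univ.erase v) (by simp)
    fun j => algebraMap (MvPolynomial σ ℂ) (RatFn σ) (MvPolynomial.X j) ^ m j]
  refine Finset.prod_congr rfl fun j _ => ?_
  rw [map_zpow₀, inclNe_algebraMap, MvPolynomial.rename_X]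

/-- `φ` is the expansion in powers of `v ^ ε`. -/
structure IsExpansionAt (v : σ) (ε : ℤ)
    (φ : RatFn σ →+* LaurentSeries (RatFn {j : σ // j ≠ v})) : Prop where
  map_X : φ (algebraMap (MvPolynomial σ ℂ) (RatFn σ) (MvPolynomial.X v)) = single ε 1
  map_incl : ∀ H, φ (inclNe v H) = C H

theorem isExpansionAt_lift (v : σ) {ε : ℤ} (hε : ε ≠ 0) :
    IsExpansionAt v ε (IsFractionRing.lift
      (g := (laurentSubst (RatFn {j : σ // j ≠ v}) ε).comp (polyIn v))
      ((laurentSubst_injective _ hε).comp (polyIn_injective v))) where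
  map_X := by
    rw [IsFractionRing.lift_algebraMap]
    simp [polyIn, laurentSubst]
  map_incl := by
    intro H
    suffices key : (IsFractionRing.lift
        (g := (laurentSubst (RatFn {j : σ // j ≠ v}) ε).comp (polyIn v))
        ((laurentSubst_injective _ hε).comp (polyIn_injective v))).comp (inclNe v) =
        (C : RatFn {j : σ // j ≠ v} →+* LaurentSeries (RatFn {j : σ // j ≠ v})) from
      RingHom.congr_fun key H
    refine IsLocalization.ringHom_ext (nonZeroDivisors (MvPolynomial {j : σ // j ≠ v} ℂ)) ?_
    apply MvPolynomial.ringHom_ext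
    · intro c
      simp only [RingHom.comp_apply]
      rw [inclNe_algebraMap, IsFractionRing.lift_algebraMap]
      simp [polyIn, laurentSubst, IsScalarTower.algebraMap_apply ℂ
        (MvPolynomial {j : σ // j ≠ v} ℂ) (RatFn {j : σ // j ≠ v})]
    · intro j
      simp only [RingHom.comp_apply]
      rw [inclNe_algebraMap, IsFractionRing.lift_algebraMap]
      simp [polyIn, laurentSubst, j.2]

theorem isExpansionAt_expandAtZero (v : σ) : IsExpansionAt v 1 (expandAtZero v) :=
  isExpansionAt_lift v one_ne_zero

theorem isExpansionAt_expandAtInfty (v : σ) : IsExpansionAt v (-1) (expandAtInfty v) :=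
  isExpansionAt_lift v (neg_ne_zero.mpr one_ne_zero)

variable {v : σ} {ε : ℤ} {φ : RatFn σ →+* LaurentSeries (RatFn {j : σ // j ≠ v})}

theorem IsExpansionAt.map_ratMonomial (hφ : IsExpansionAt v ε φ) (m : σ → ℤ) :
    φ (ratMonomial m) = single (ε * m v) (ratMonomial fun j : {j : σ // j ≠ v} => m j) := by
  rw [ratMonomial_eq_inclNe_mul v, map_mul, hφ.map_incl, map_zpow₀, hφ.map_X, single_one_zpow,
    C_apply, single_mul_single, zero_add, mul_one, smul_eq_mul, mul_comm]

theorem IsExpansionAt.map_algebraMap_C (hφ : IsExpansionAt v ε φ) (c : ℂ) :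
    φ (algebraMap ℂ (RatFn σ) c) = C (algebraMap ℂ _ c) := by
  rw [← inclNe_algebraMap_C v, hφ.map_incl]

/-- Counterpart in `K((v^ε))` of `supportBound_expand_elliottTerm`. The extra sign `δ` allows bounds
on both sides when the factors are free of `v`. -/
theorem IsExpansionAt.supportBound_elliottTerm (hφ : IsExpansionAt v ε φ) (δ : ℤ) (c : ℂ)
    (a : σ → ℤ) {s : Multiset (σ → ℤ)} (hs : ∀ m ∈ s, 0 ≤ ε * m v ∧ 0 ≤ δ * (ε * m v)) :
    SupportBound (δ • AddMonoidHom.id ℤ) (δ * (ε * a v)) (φ (elliottTerm c a s)) := by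
  have hfac : ∀ m ∈ s, SupportBound (δ • AddMonoidHom.id ℤ) 0
      (1 - single (ε * m v) (ratMonomial fun j : {j : σ // j ≠ v} => m j))⁻¹ := by
    intro m hm
    -- A factor free of `v` is a constant of `K((v^ε))`, so its inverse is a constant too; the
    -- minimal exponent argument needs a positive exponent.
    rcases (hs m hm).1.eq_or_lt with h0 | h0
    · have : (1 - single (ε * m v) (ratMonomial fun j : {j : σ // j ≠ v} => m j))⁻¹ =
          (C (1 - ratMonomial fun j : {j : σ // j ≠ v} => m j)⁻¹ :
            LaurentSeries (RatFn {j : σ // j ≠ v})) := by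
        rw [← h0, ← C_apply, map_inv₀, map_sub, map_one]
      rw [this]
      exact supportBound_C _ _
    · exact supportBound_inv_one_sub_single _ h0 (hs m hm).2 _
  have h := ((supportBound_C (δ • AddMonoidHom.id ℤ)
    (algebraMap ℂ (RatFn {j : σ // j ≠ v}) c)).mul (supportBound_single (δ • AddMonoidHom.id ℤ)
    (ε * a v) (ratMonomial fun j : {j : σ // j ≠ v} => a j))).mul
    (supportBound_multiset_prod (δ • AddMonoidHom.id ℤ) s _ hfac)
  rw [zero_add, add_zero] at h
  have hT := map_elliottTerm (L := LaurentSeries (RatFn {j : σ // j ≠ v})) φ c a s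
  simp only [hφ.map_ratMonomial, hφ.map_algebraMap_C] at hT
  rw [hT]
  exact h

theorem coeff_zero_eq_zero_of_supportBound {R : Type*} [Field R] {δ t : ℤ} {f : LaurentSeries R}
    (hf : SupportBound (δ • AddMonoidHom.id ℤ) t f) (ht : 0 < t) : f.coeff 0 = 0 := by
  by_contra h
  have := hf 0 h
  rw [map_zero] at this
  omega

/-- The constant term in `v` with respect to `ρ` agrees with the one given by the expansion `φ`. -/
def CTAgrees (ρ : GroupOrder σ) (S : AddSubgroup (σ → ℤ))
    (φ : RatFn σ →+* LaurentSeries (RatFn {j : σ // j ≠ v})) (F : RatFn σ) : Prop :=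
  inclNe v ((φ F).coeff 0) ∈ elliottSpan (freeOf S v) ∧
    expand ρ (inclNe v ((φ F).coeff 0)) = constTerm v (expand ρ F)

theorem CTAgrees.add {ρ : GroupOrder σ} {S : AddSubgroup (σ → ℤ)} {F G : RatFn σ}
    (hF : CTAgrees ρ S φ F) (hG : CTAgrees ρ S φ G) : CTAgrees ρ S φ (F + G) := by
  constructor
  · rw [map_add, coeff_add, map_add]
    exact add_mem hF.1 hG.1
  · rw [map_add, coeff_add, map_add, map_add, hF.2, hG.2, map_add, constTerm_add]

theorem cTAgrees_of_eq_zero {ρ : GroupOrder σ} {S : AddSubgroup (σ → ℤ)} {F : RatFn σ}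
    (hφ : (φ F).coeff 0 = 0) (hρ : constTerm v (expand ρ F) = 0) : CTAgrees ρ S φ F := by
  rw [CTAgrees, hφ, hρ, map_zero, map_zero]
  exact ⟨zero_mem _, rfl⟩

theorem elliottTerm_cons_eq_add (ρ : GroupOrder σ) (c : ℂ) (a : σ → ℤ) {m : σ → ℤ} (hm : m ≠ 0)
    (s : Multiset (σ → ℤ)) :
    elliottTerm c a (m ::ₘ s) = elliottTerm c a s + elliottTerm c (a + m) (m ::ₘ s) := by
  rw [elliottTerm_add, elliottTerm_cons]
  have := one_sub_ratMonomial_ne_zero ρ hm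
  field_simp
  ring

theorem ne_zero_of_of_pos {ρ : GroupOrder σ} {m : σ → ℤ} (hm : 0 < OrdExp.of ρ m) : m ≠ 0 := by
  rintro rfl
  rw [map_zero] at hm
  exact lt_irrefl _ hm

/-- Here only `x^a` can involve `v`: if it does, both constant terms vanish; otherwise both are the
whole term. -/
theorem IsExpansionAt.cTAgrees_elliottTerm_of_free (hφ : IsExpansionAt v ε φ) (hε : ε ≠ 0)
    (ρ : GroupOrder σ) {S : AddSubgroup (σ → ℤ)} (c : ℂ) {a : σ → ℤ} {s : Multiset (σ → ℤ)}
    (ha : a ∈ S) (hs : ∀ m ∈ s, m ∈ S ∧ 0 < OrdExp.of ρ m ∧ m v = 0) :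
    CTAgrees ρ S φ (elliottTerm c a s) := by
  have hvan : ∀ δ : ℤ, 0 < δ * (ε * a v) → CTAgrees ρ S φ (elliottTerm c a s) := by
    intro δ hδ
    refine cTAgrees_of_eq_zero
      (coeff_zero_eq_zero_of_supportBound (hφ.supportBound_elliottTerm δ c a ?_) hδ)
      (constTerm_eq_zero_of_supportBound (supportBound_expand_elliottTerm ρ v (δ * ε) c a ?_) ?_)
    · intro m hm
      simp [(hs m hm).2.2]
    · intro m hm
      simp [(hs m hm).2.1, (hs m hm).2.2]
    · rwa [mul_assoc]
  rcases lt_trichotomy (ε * a v) 0 with h | h | h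
  · exact hvan (-1) (by omega)
  · have hav : a v = 0 := by simpa [hε] using h
    have hmon : ∀ m : σ → ℤ, m v = 0 →
        ratMonomial m = inclNe v (ratMonomial fun j => m j) := by
      intro m hm
      rw [ratMonomial_eq_inclNe_mul v m, hm, zpow_zero, mul_one]
    have hT : ∃ H, elliottTerm c a s = inclNe v H := by
      refine ⟨elliottTerm c (fun j => a j) (s.map fun m j => m j), ?_⟩
      rw [map_elliottTerm, inclNe_algebraMap_C, ← hmon a hav, Multiset.map_map, elliottTerm]
      congr 2
      refine Multiset.map_congr rfl fun m hm => ?_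
      rw [Function.comp_apply, ← hmon m (hs m hm).2.2]
    obtain ⟨H, hH⟩ := hT
    have hc : inclNe v ((φ (elliottTerm c a s)).coeff 0) = elliottTerm c a s := by
      rw [hH, hφ.map_incl, C_apply, coeff_single_same]
    rw [CTAgrees, hc]
    refine ⟨elliottTerm_mem_elliottSpan c ⟨ha, hav⟩ fun m hm =>
      ⟨⟨(hs m hm).1, (hs m hm).2.2⟩, ne_zero_of_of_pos (hs m hm).2.1⟩, ?_⟩
    have hb : ∀ δ : ℤ, SupportBound (δ • OrdExp.degree ρ v) 0 (expand ρ (elliottTerm c a s)) := by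
      intro δ
      have := supportBound_expand_elliottTerm ρ v δ c a (s := s) fun m hm => by
        simp [(hs m hm).2.1, (hs m hm).2.2]
      rwa [hav, mul_zero] at this
    exact (constTerm_eq_self_of_supportBound (hb 1) (hb (-1))).symm
  · exact hvan 1 (by omega)

/-- Peeling off `1/(1 - x^m) = 1 + x^m/(1 - x^m)` either drops a factor or pushes the numerator
further in the direction `ε`. Once `ε * a v` is positive, both constant terms are zero. -/
theorem IsExpansionAt.cTAgrees_elliottTerm (hφ : IsExpansionAt v ε φ) (hε : ε ≠ 0)
    (ρ : GroupOrder σ) {S : AddSubgroup (σ → ℤ)} (c : ℂ) {a : σ → ℤ} {s : Multiset (σ → ℤ)}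
    (ha : a ∈ S) (hs : ∀ m ∈ s, m ∈ S ∧ 0 < OrdExp.of ρ m ∧ 0 ≤ ε * m v) :
    CTAgrees ρ S φ (elliottTerm c a s) := by
  -- The `1 -` keeps the measure strictly decreasing when the numerator has `v`-degree `0`, a case
  -- that still has to be peeled.
  induction hN : (1 - ε * a v).toNat + s.card using Nat.strong_induction_on generalizing a s with
  | _ N ih =>
    subst hN
    by_cases hpos : 0 < ε * a v
    · refine cTAgrees_of_eq_zero (coeff_zero_eq_zero_of_supportBound
        (hφ.supportBound_elliottTerm 1 c a fun m hm => ?_) (by rwa [one_mul]))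
        (constTerm_eq_zero_of_supportBound (supportBound_expand_elliottTerm ρ v ε c a
          fun m hm => (hs m hm).2) hpos)
      rw [one_mul]
      exact ⟨(hs m hm).2.2, (hs m hm).2.2⟩
    by_cases hfree : ∀ m ∈ s, m v = 0
    · exact hφ.cTAgrees_elliottTerm_of_free hε ρ c ha fun m hm =>
        ⟨(hs m hm).1, (hs m hm).2.1, hfree m hm⟩
    push Not at hfree
    obtain ⟨m, hm, hmv⟩ := hfree
    obtain ⟨hmS, hm0, hmε⟩ := hs m hm
    have hmpos : 0 < ε * m v := hmε.lt_of_ne (mul_ne_zero hε hmv).symm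
    obtain ⟨t, rfl⟩ := Multiset.exists_cons_of_mem hm
    rw [elliottTerm_cons_eq_add ρ c a (ne_zero_of_of_pos hm0)]
    refine (ih _ ?_ ha (fun x hx => hs x (Multiset.mem_cons_of_mem hx)) rfl).add
      (ih _ ?_ (add_mem ha hmS) hs rfl)
    · rw [Multiset.card_cons]
      omega
    · rw [Pi.add_apply, mul_add]
      omega

end Direction

/-! ### Reciprocity for one variable -/

section Reciprocity

variable {σ : Type} [Fintype σ] [DecidableEq σ]

theorem elliottTerm_cons_neg (c : ℂ) (a m : σ → ℤ) (s : Multiset (σ → ℤ)) :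
    elliottTerm c a (m ::ₘ s) = elliottTerm (-c) (a - m) (-m ::ₘ s) := by
  have h : (1 - ratMonomial m)⁻¹ = -((ratMonomial m)⁻¹ * (1 - (ratMonomial m)⁻¹)⁻¹) := by
    rw [← mul_inv, mul_sub, mul_inv_cancel₀ (ratMonomial_ne_zero m), mul_one, ← inv_neg, neg_sub]
  rw [elliottTerm_neg, sub_eq_add_neg, elliottTerm_add, elliottTerm_cons, elliottTerm_cons,
    ratMonomial_neg, h]
  ring

/-- The factors of an Elliott term can be reoriented at will. -/
theorem exists_elliottTerm_map_eq {S : AddSubgroup (σ → ℤ)} {f : (σ → ℤ) → σ → ℤ}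
    (hf : ∀ m, f m = m ∨ f m = -m) (c : ℂ) {a : σ → ℤ} {s : Multiset (σ → ℤ)} (ha : a ∈ S)
    (hs : ∀ m ∈ s, m ∈ S) :
    ∃ c' a', a' ∈ S ∧ elliottTerm c a s = elliottTerm c' a' (s.map f) := by
  induction s using Multiset.induction_on with
  | empty => exact ⟨c, a, ha, rfl⟩
  | cons m s ih =>
    obtain ⟨c', a', ha', h⟩ := ih fun x hx => hs x (Multiset.mem_cons_of_mem hx)
    have h2 : elliottTerm c a (m ::ₘ s) = elliottTerm c' a' (m ::ₘ s.map f) := by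
      rw [elliottTerm_cons, elliottTerm_cons, h]
    rw [Multiset.map_cons]
    rcases hf m with hm | hm
    · exact ⟨c', a', ha', by rw [hm, h2]⟩
    · exact ⟨-c', a' - m, sub_mem ha' (hs m (Multiset.mem_cons_self m s)),
        by rw [hm, h2, elliottTerm_cons_neg]⟩

theorem OrdExp.of_reverse_neg_pos {ρ : GroupOrder σ} {m : σ → ℤ} (hm : 0 < OrdExp.of ρ m) :
    0 < OrdExp.of ρ.reverse (-m) := by
  rw [← not_le] at hm ⊢
  intro h
  apply hm
  have h' : ρ.le 0 (-m) := h
  have := ρ.add_le_add 0 (-m) m h'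
  rw [zero_add, neg_add_cancel] at this
  exact this

/-- The constant terms of `F` in `v` with respect to `ρ` and its reverse are rational functions
with sum `I_v F`. -/
def HasReciprocalCT (ρ : GroupOrder σ) (v : σ) (S : AddSubgroup (σ → ℤ)) (F : RatFn σ) : Prop :=
  ∃ G ∈ elliottSpan (freeOf S v), ∃ G' ∈ elliottSpan (freeOf S v),
    expand ρ G = constTerm v (expand ρ F) ∧
    expand ρ.reverse G' = constTerm v (expand ρ.reverse F) ∧
    inclNe v (invariantI v F) = G + G'

variable {ρ : GroupOrder σ} {v : σ} {S : AddSubgroup (σ → ℤ)}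

theorem hasReciprocalCT_zero : HasReciprocalCT ρ v S 0 :=
  ⟨0, zero_mem _, 0, zero_mem _, by simp [constTerm_zero], by simp [constTerm_zero],
    by simp [invariantI]⟩

theorem HasReciprocalCT.add {F F' : RatFn σ} (hF : HasReciprocalCT ρ v S F)
    (hF' : HasReciprocalCT ρ v S F') : HasReciprocalCT ρ v S (F + F') := by
  obtain ⟨G, hG, H, hH, h1, h2, h3⟩ := hF
  obtain ⟨G', hG', H', hH', h1', h2', h3'⟩ := hF'
  refine ⟨G + G', add_mem hG hG', H + H', add_mem hH hH', ?_, ?_, ?_⟩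
  · rw [map_add, map_add, constTerm_add, h1, h1']
  · rw [map_add, map_add, constTerm_add, h2, h2']
  · have hadd : invariantI v (F + F') = invariantI v F + invariantI v F' := by
      simp only [invariantI, map_add, coeff_add]
      ring
    rw [hadd, map_add, h3, h3']
    ring

theorem HasReciprocalCT.sum {ι : Type*} {s : Finset ι} {F : ι → RatFn σ}
    (hF : ∀ i ∈ s, HasReciprocalCT ρ v S (F i)) : HasReciprocalCT ρ v S (∑ i ∈ s, F i) :=
  Finset.sum_induction F _ (fun _ _ => HasReciprocalCT.add) hasReciprocalCT_zero hF

theorem hasReciprocalCT_of_cTAgrees {F : RatFn σ}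
    {φ ψ : RatFn σ →+* LaurentSeries (RatFn {j : σ // j ≠ v})}
    (hI : invariantI v F = (φ F).coeff 0 + (ψ F).coeff 0) (hφ : CTAgrees ρ S φ F)
    (hψ : CTAgrees ρ.reverse S ψ F) : HasReciprocalCT ρ v S F :=
  ⟨_, hφ.1, _, hψ.1, hφ.2, hψ.2, by rw [hI, map_add]⟩

/-- Terms whose factors all point in the direction `ε`. -/
theorem hasReciprocalCT_elliottTerm_of_direction {ε : ℤ} (hε : ε = 1 ∨ ε = -1) (c : ℂ)
    {a : σ → ℤ} {s : Multiset (σ → ℤ)} (ha : a ∈ S)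
    (hs : ∀ m ∈ s, m ∈ S ∧ 0 < OrdExp.of ρ m ∧ 0 ≤ ε * m v) :
    HasReciprocalCT ρ v S (elliottTerm c a s) := by
  -- Replacing each `m` by `-m` makes the factors `ρ̄`-positive and reverses their direction in `v`,
  -- so `ρ̄` goes with the opposite expansion.
  have hrev : ∀ ψ : RatFn σ →+* LaurentSeries (RatFn {j : σ // j ≠ v}),
      IsExpansionAt v (-ε) ψ → CTAgrees ρ.reverse S ψ (elliottTerm c a s) := by
    intro ψ hψ
    obtain ⟨c', a', ha', h⟩ := exists_elliottTerm_map_eq (f := fun m => -m)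
      (fun m => Or.inr rfl) c ha fun m hm => (hs m hm).1
    rw [h]
    refine hψ.cTAgrees_elliottTerm (by omega) ρ.reverse c' ha' fun m hm => ?_
    obtain ⟨m, hm', rfl⟩ := Multiset.mem_map.mp hm
    obtain ⟨h1, h2, h3⟩ := hs m hm'
    exact ⟨neg_mem h1, OrdExp.of_reverse_neg_pos h2, by rwa [Pi.neg_apply, neg_mul_neg]⟩
  rcases hε with rfl | rfl
  · exact hasReciprocalCT_of_cTAgrees rfl
      ((isExpansionAt_expandAtZero v).cTAgrees_elliottTerm one_ne_zero ρ c ha hs)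
      (hrev _ (isExpansionAt_expandAtInfty v))
  · exact hasReciprocalCT_of_cTAgrees (add_comm _ _)
      ((isExpansionAt_expandAtInfty v).cTAgrees_elliottTerm (by norm_num) ρ c ha hs)
      (hrev _ (isExpansionAt_expandAtZero v))

/-- Elliott's reduction identity. -/
theorem elliottTerm_cons_cons (ρ : GroupOrder σ) (c : ℂ) (a : σ → ℤ) {x y : σ → ℤ} (hx : x ≠ 0)
    (hy : y ≠ 0) (hxy : x + y ≠ 0) (s : Multiset (σ → ℤ)) :
    elliottTerm c a (x ::ₘ y ::ₘ s) = elliottTerm c a (x ::ₘ (x + y) ::ₘ s) +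
      elliottTerm c a (y ::ₘ (x + y) ::ₘ s) + elliottTerm (-c) a ((x + y) ::ₘ s) := by
  have h1 := one_sub_ratMonomial_ne_zero ρ hx
  have h2 := one_sub_ratMonomial_ne_zero ρ hy
  have h3 := one_sub_ratMonomial_ne_zero ρ hxy
  simp only [elliottTerm_cons, elliottTerm_neg]
  rw [ratMonomial_add] at h3 ⊢
  field_simp
  ring

/-- As long as both `M` and `-M` occur as `v`-degrees, Elliott's identity applies to such a pair
`x`, `y`. Since `x + y` is free of `v`, each resulting term has fewer factors involving `v`; the
process ends with a single direction. -/
theorem hasReciprocalCT_elliottTerm_of_uniform {M : ℤ} (hM : 0 < M) (c : ℂ) {a : σ → ℤ}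
    {s : Multiset (σ → ℤ)} (ha : a ∈ S)
    (hs : ∀ m ∈ s, m ∈ S ∧ 0 < OrdExp.of ρ m ∧ (m v = 0 ∨ m v = M ∨ m v = -M)) :
    HasReciprocalCT ρ v S (elliottTerm c a s) := by
  induction hN : s.countP (fun m => m v ≠ 0) using Nat.strong_induction_on generalizing c s with
  | _ N ih =>
    subst hN
    by_cases hneg : ∀ m ∈ s, m v ≠ -M
    · refine hasReciprocalCT_elliottTerm_of_direction (Or.inl rfl) c ha fun m hm =>
        ⟨(hs m hm).1, (hs m hm).2.1, ?_⟩
      have := hneg m hm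
      rcases (hs m hm).2.2 with h | h | h <;> omega
    by_cases hpos : ∀ m ∈ s, m v ≠ M
    · refine hasReciprocalCT_elliottTerm_of_direction (Or.inr rfl) c ha fun m hm =>
        ⟨(hs m hm).1, (hs m hm).2.1, ?_⟩
      have := hpos m hm
      rcases (hs m hm).2.2 with h | h | h <;> omega
    push Not at hneg hpos
    obtain ⟨x, hx, hxv⟩ := hpos
    obtain ⟨t, rfl⟩ := Multiset.exists_cons_of_mem hx
    obtain ⟨y, hy, hyv⟩ := hneg
    have hyt : y ∈ t := by
      rcases Multiset.mem_cons.mp hy with rfl | h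
      · omega
      · exact h
    obtain ⟨u, rfl⟩ := Multiset.exists_cons_of_mem hyt
    simp only [Multiset.forall_mem_cons] at hs
    obtain ⟨hx', hy', hu⟩ := hs
    have hxyv : (x + y) v = 0 := by rw [Pi.add_apply, hxv, hyv, add_neg_cancel]
    have hxy0 : 0 < OrdExp.of ρ (x + y) := by
      rw [map_add]
      exact add_pos hx'.2.1 hy'.2.1
    have hxy' : x + y ∈ S ∧ 0 < OrdExp.of ρ (x + y) ∧
        ((x + y) v = 0 ∨ (x + y) v = M ∨ (x + y) v = -M) :=
      ⟨add_mem hx'.1 hy'.1, hxy0, Or.inl hxyv⟩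
    have hxn : x v ≠ 0 := by omega
    have hyn : y v ≠ 0 := by omega
    rw [elliottTerm_cons_cons ρ c a (ne_zero_of_of_pos hx'.2.1) (ne_zero_of_of_pos hy'.2.1)
      (ne_zero_of_of_pos hxy0)]
    refine ((ih _ ?_ c ?_ rfl).add (ih _ ?_ c ?_ rfl)).add (ih _ ?_ (-c) ?_ rfl)
    · simp [hxn, hyn, hxyv, -Pi.add_apply]
    · simp only [Multiset.forall_mem_cons]
      exact ⟨hx', hxy', hu⟩
    · simp [hxn, hyn, hxyv, -Pi.add_apply]
    · simp only [Multiset.forall_mem_cons]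
      exact ⟨hy', hxy', hu⟩
    · simp [hxn, hyn, hxyv, -Pi.add_apply]
    · simp only [Multiset.forall_mem_cons]
      exact ⟨hxy', hu⟩

/-- This is `1/(1 - x^m) = (1 + x^m + ⋯ + x^((k-1)m)) / (1 - x^(km))`. -/
theorem elliottTerm_cons_eq_sum (ρ : GroupOrder σ) (c : ℂ) (a : σ → ℤ) {m : σ → ℤ} (hm : m ≠ 0)
    {k : ℕ} (hk : k ≠ 0) (s : Multiset (σ → ℤ)) : elliottTerm c a (m ::ₘ s) =
      ∑ j ∈ Finset.range k, elliottTerm c (a + j • m) ((k • m) ::ₘ s) := by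
  have h1 := one_sub_ratMonomial_ne_zero ρ hm
  have h2 := one_sub_ratMonomial_ne_zero ρ (smul_ne_zero hk hm)
  simp only [elliottTerm_add, elliottTerm_cons, ratMonomial_nsmul] at h2 ⊢
  rw [← Finset.mul_sum, ← Finset.sum_mul, ← mul_assoc]
  congr 1
  refine (eq_inv_of_mul_eq_one_left ?_).symm
  rw [mul_assoc, mul_comm (∑ j ∈ _, _), mul_neg_geom_sum, inv_mul_cancel₀ h2]

/-- The multiset `s` holds the factors still to be rescaled and `t` those already normalized; the
induction moves them across one by one. -/
theorem hasReciprocalCT_elliottTerm_add {M : ℤ} (hM : 0 < M) (c : ℂ) {a : σ → ℤ}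
    {s t : Multiset (σ → ℤ)} (ha : a ∈ S)
    (hs : ∀ m ∈ s, m ∈ S ∧ 0 < OrdExp.of ρ m ∧ (m v = 0 ∨ m v ∣ M))
    (ht : ∀ m ∈ t, m ∈ S ∧ 0 < OrdExp.of ρ m ∧ (m v = 0 ∨ m v = M ∨ m v = -M)) :
    HasReciprocalCT ρ v S (elliottTerm c a (s + t)) := by
  induction s using Multiset.induction_on generalizing a t with
  | empty => simpa using hasReciprocalCT_elliottTerm_of_uniform hM c ha ht
  | cons m s ih =>
    rw [Multiset.forall_mem_cons] at hs
    obtain ⟨⟨hmS, hm0, hmv⟩, hs⟩ := hs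
    by_cases hz : m v = 0
    · rw [Multiset.cons_add, ← Multiset.add_cons]
      refine ih ha hs ?_
      rw [Multiset.forall_mem_cons]
      exact ⟨⟨hmS, hm0, Or.inl hz⟩, ht⟩
    · obtain ⟨q, hq⟩ := hmv.resolve_left hz
      have hq0 : q.natAbs ≠ 0 := by
        rw [Ne, Int.natAbs_eq_zero]
        rintro rfl
        omega
      -- The multiplier is `|q|` rather than `q`, so that the rescaled exponent stays `ρ`-positive;
      -- the sign of `q` then decides between `M` and `-M`.
      rw [Multiset.cons_add, elliottTerm_cons_eq_sum ρ c a (ne_zero_of_of_pos hm0) hq0]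
      refine HasReciprocalCT.sum fun j _ => ?_
      rw [← Multiset.add_cons]
      refine ih (add_mem ha (nsmul_mem hmS j)) hs ?_
      rw [Multiset.forall_mem_cons]
      refine ⟨⟨nsmul_mem hmS _, ?_, Or.inr ?_⟩, ht⟩
      · rw [map_nsmul]
        exact nsmul_pos hm0 hq0
      · rw [Pi.smul_apply, nsmul_eq_mul, hq]
        rcases q.natAbs_eq with h | h
        · left
          rw [← h, mul_comm]
        · right
          nth_rw 2 [h]
          ring

theorem hasReciprocalCT_of_mem_elliottSpan (ρ : GroupOrder σ) (v : σ) {F : RatFn σ}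
    (hF : F ∈ elliottSpan S) : HasReciprocalCT ρ v S F := by
  induction hF using AddSubmonoid.closure_induction with
  | mem F hF =>
    obtain ⟨c, a, s, ha, hs, rfl⟩ := hF
    classical
    let f : (σ → ℤ) → σ → ℤ := fun m => if 0 ≤ OrdExp.of ρ m then m else -m
    have hf : ∀ m, f m = m ∨ f m = -m := by
      intro m
      by_cases h : 0 ≤ OrdExp.of ρ m
      · exact Or.inl (if_pos h)
      · exact Or.inr (if_neg h)
    obtain ⟨c', a', ha', h⟩ := exists_elliottTerm_map_eq hf c ha fun m hm => (hs m hm).1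
    have hmap : ∀ m ∈ s.map f, m ∈ S ∧ 0 < OrdExp.of ρ m := by
      intro m hm
      obtain ⟨m, hm', rfl⟩ := Multiset.mem_map.mp hm
      obtain ⟨hmS, hm0⟩ := hs m hm'
      constructor
      · rcases hf m with h | h <;> rw [h]
        · exact hmS
        · exact neg_mem hmS
      · by_cases h : 0 ≤ OrdExp.of ρ m
        · rw [show f m = m from if_pos h]
          refine h.lt_of_ne fun h0 => hm0 (OrdExp.of_injective ρ ?_)
          rw [← h0, map_zero]
        · rw [show f m = -m from if_neg h, map_neg, neg_pos]
          exact not_le.mp h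
    -- The product of the nonzero `|m v|` serves as common multiple.
    have hM : ∀ s : Multiset (σ → ℤ), ∃ M : ℤ, 0 < M ∧ ∀ m ∈ s, m v = 0 ∨ m v ∣ M := by
      intro s
      induction s using Multiset.induction_on with
      | empty => exact ⟨1, one_pos, by simp⟩
      | cons m s ih =>
        obtain ⟨M, hM, h⟩ := ih
        by_cases hm : m v = 0
        · exact ⟨M, hM, Multiset.forall_mem_cons.mpr ⟨Or.inl hm, h⟩⟩
        · refine ⟨|m v| * M, mul_pos (abs_pos.mpr hm) hM, Multiset.forall_mem_cons.mpr
            ⟨Or.inr (Dvd.dvd.mul_right ((dvd_abs _ _).mpr dvd_rfl) M), fun x hx => ?_⟩⟩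
          exact (h x hx).imp_right fun hd => hd.mul_left _
    obtain ⟨M, hM0, hM⟩ := hM (s.map f)
    rw [h, ← add_zero (s.map f)]
    exact hasReciprocalCT_elliottTerm_add hM0 c' ha'
      (fun m hm => ⟨(hmap m hm).1, (hmap m hm).2, hM m hm⟩) (by simp)
  | zero => exact hasReciprocalCT_zero
  | add F G _ _ hF hG => exact hF.add hG

end Reciprocity

/-! ### Iterated constant terms -/

section Iterate

variable {r n : ℕ}

theorem iterConstTerm_succ {ρ : GroupOrder (Fin r ⊕ Fin n)} (f : MNSeries ρ) (i : Fin r) :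
    iterConstTerm f i.succ = constTerm (Sum.inl i) (iterConstTerm f i.castSucc) :=
  Fin.induction_succ _ _ _

/-- Exponent vectors free of the variables `λ₁, …, λ_k`. -/
def freeOfInit (r n k : ℕ) : AddSubgroup (Fin r ⊕ Fin n → ℤ) where
  carrier := {m | ∀ i : Fin r, (i : ℕ) < k → m (Sum.inl i) = 0}
  zero_mem' := fun _ _ => rfl
  add_mem' := fun ha hb i hi => by rw [Pi.add_apply, ha i hi, hb i hi, add_zero]
  neg_mem' := fun ha i hi => by rw [Pi.neg_apply, ha i hi, neg_zero]

theorem freeOf_freeOfInit (i : Fin r) :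
    freeOf (freeOfInit r n i) (Sum.inl i) = freeOfInit r n (i + 1) := by
  ext m
  constructor
  · rintro ⟨h1, h2⟩ j hj
    rcases Nat.lt_succ_iff_lt_or_eq.mp hj with h | h
    · exact h1 j h
    · rw [Fin.ext h]
      exact h2
  · exact fun h => ⟨fun j hj => h j (hj.trans (Nat.lt_succ_self _)), h i (Nat.lt_succ_self _)⟩

theorem freeOfInit_zero : freeOfInit r n 0 = ⊤ :=
  eq_top_iff.mpr fun _ _ i hi => absurd hi (Nat.not_lt_zero i)

theorem elliottSpan_freeOfInit_le_range {F : RatFn (Fin r ⊕ Fin n)}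
    (hF : F ∈ elliottSpan (freeOfInit r n r)) : ∃ G, inclX r n G = F := by
  have hmon : ∀ m ∈ freeOfInit r n r, ratMonomial m ∈ (inclX r n).fieldRange := by
    intro m hm
    rw [ratMonomial, Fintype.prod_sum_type]
    refine mul_mem (prod_mem fun i _ => ?_) (prod_mem fun j _ => zpow_mem ?_ _)
    · rw [hm i i.2, zpow_zero]
      exact one_mem _
    · refine ⟨algebraMap (MvPolynomial (Fin n) ℂ) (RatFn (Fin n)) (MvPolynomial.X j), ?_⟩
      rw [inclX, IsFractionRing.map, IsLocalization.map_eq]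
      simp
  change F ∈ (inclX r n).fieldRange
  induction hF using AddSubmonoid.closure_induction with
  | mem F hF =>
    obtain ⟨c, a, s, ha, hs, rfl⟩ := hF
    rw [elliottTerm]
    refine mul_mem (mul_mem ⟨algebraMap ℂ _ c, ?_⟩ (hmon a ha)) (multiset_prod_mem _ fun y hy => ?_)
    · rw [IsScalarTower.algebraMap_apply ℂ (MvPolynomial (Fin n) ℂ) (RatFn (Fin n)), inclX,
        IsFractionRing.map, IsLocalization.map_eq,
        IsScalarTower.algebraMap_apply ℂ (MvPolynomial (Fin r ⊕ Fin n) ℂ) (RatFn (Fin r ⊕ Fin n))]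
      simp [MvPolynomial.algebraMap_eq]
    · obtain ⟨m, hm, rfl⟩ := Multiset.mem_map.mp hy
      exact inv_mem (sub_mem (one_mem _) (hmon m (hs m hm).1))
  | zero => exact zero_mem _
  | add F G _ _ hF hG => exact add_mem hF hG

/-- Membership in the span is carried along because it makes the reciprocity available for the next
variable. It also yields the rational function to which the I-property is applied. -/
theorem IProperty.exists_isIterCT {ρ : GroupOrder (Fin r ⊕ Fin n)} {F : RatFn (Fin r ⊕ Fin n)}
    (hF : IsElliottRational F) (hI : IProperty ρ F) (k : Fin (r + 1)) :
    ∃ G ∈ elliottSpan (freeOfInit r n k), IsIterCT ρ k F G ∧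
      IsIterCT ρ.reverse k F ((-1) ^ (k : ℕ) * G) := by
  induction k using Fin.induction with
  | zero =>
    refine ⟨F, ?_, rfl, ?_⟩
    · rw [Fin.val_zero, freeOfInit_zero]
      exact hF.mem_elliottSpan
    · rw [Fin.val_zero, pow_zero, one_mul]
      rfl
  | succ i ih =>
    obtain ⟨G, hG, h1, h2⟩ := ih
    rw [Fin.val_castSucc] at hG h2
    obtain ⟨H, hH, H', _, e1, e2, e3⟩ := hasReciprocalCT_of_mem_elliottSpan ρ (Sum.inl i) hG
    rw [freeOf_freeOfInit] at hH
    rw [hI i G h1, map_zero] at e3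
    have e4 : H' = -H := (neg_eq_of_add_eq_zero_right e3.symm).symm
    refine ⟨H, by rwa [Fin.val_succ], ?_, ?_⟩
    · rw [IsIterCT, iterConstTerm_succ, ← h1, e1]
    · rw [IsIterCT, iterConstTerm_succ, ← h2, Fin.val_succ, pow_succ, mul_assoc, neg_one_mul, ← e4]
      -- The sign is moved through the expansion and the constant term by treating `1` and `-1`
      -- separately.
      rcases neg_one_pow_eq_or (RatFn (Fin r ⊕ Fin n)) (i : ℕ) with h | h
      · rw [h, one_mul, one_mul, e2]
      · rw [h, neg_one_mul, neg_one_mul, map_neg, map_neg, constTerm_neg, e2]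

end Iterate

end MNRec

theorem mainTheorem8 (r n : ℕ) (ρ : MNRec.GroupOrder (Fin r ⊕ Fin n))
    (F : MNRec.RatFn (Fin r ⊕ Fin n)) (hF : MNRec.IsElliottRational F)
    (hI : MNRec.IProperty ρ F) : MNRec.RProperty ρ F := by
  obtain ⟨G, hG, h1, h2⟩ := hI.exists_isIterCT hF (Fin.last r)
  rw [Fin.val_last] at hG h2
  obtain ⟨G, rfl⟩ := MNRec.elliottSpan_freeOfInit_le_range hG
  refine ⟨G, (-1) ^ r * G, h1, ?_, ?_⟩
  · rwa [map_mul, map_pow, map_neg, map_one]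
  · rw [← mul_assoc, ← mul_pow, neg_one_mul, neg_neg, one_pow, one_mul]
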